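/- Let $d\ge 2$ be an integer and let $t$ be a real number. For a vector $a\in\mathbb{R}^d$, put $$b(a)=\frac12\sum_{i=1}^d a_i-t\qquad\text{and}\qquad H(a)=\{x\in\mathbb{R}^d:\ a\cdot x=b(a)\}$$ (so that, if $\|a\|=1$, then $H(a)$ is a hyperplane at distance $|t|$ from the center of the hypercube $[0,1]^d$). Let $V(a)\in[0,+\infty]$ denote the $(d-1)$-dimensional volume of $H(a)\cap[0,1]^d$. If $x\in[0,+\infty[^d$ has at least two non-zero coordinates, then $V(x)$ is finite and the function $a\mapsto V(a)$, defined on $\mathbb{R}^d$, is continuous at $x$. In particular, with $t$ fixed, the restriction of $V$ to the closed orthant $[0,+\infty[^d$ is continuous at every point of that orthant with at least two non-zero coordinates. -/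

import Mathlib

open scoped ENNReal MeasureTheory

noncomputable section

namespace HypercubeSection

/-- The hypercube `[0,1]^d`. -/
def cube (d : ℕ) : Set (EuclideanSpace ℝ (Fin d)) :=
  {x | ∀ i, 0 ≤ x i ∧ x i ≤ 1}

/-- The offset `b = (a₁ + ⋯ + a_d) / 2 - t`, as a function of `a`. -/
def offset {d : ℕ} (t : ℝ) (a : EuclideanSpace ℝ (Fin d)) : ℝ :=
  (1 / 2) * ∑ i, a i - t

/-- The set `H` of the points `x` with `a · x = b`: a hyperplane as soon as `a ≠ 0`. -/
def hyperplane {d : ℕ} (t : ℝ) (a : EuclideanSpace ℝ (Fin d)) : Set (EuclideanSpace ℝ (Fin d)) :=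
  {x | inner ℝ a x = offset t a}

/-- The `(d-1)`-dimensional volume of `H ∩ [0,1]^d` as a function of `a`. The measure `μHE[d - 1]`
is the `(d-1)`-dimensional Hausdorff measure of the Euclidean space `ℝ^d`, normalized so that it is
the Lebesgue measure on every `(d-1)`-dimensional affine subspace. -/
def sectionVolume {d : ℕ} (t : ℝ) (a : EuclideanSpace ℝ (Fin d)) : ℝ≥0∞ :=
  μHE[d - 1] (hyperplane t a ∩ cube d)

end HypercubeSection

end

open MeasureTheory Filter Topology Set

namespace HypercubeSection

/-! Fix `i` with `x i ≠ 0`. For `a` near `x` the section is the graph, over a domain `D(a)` in the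
other coordinates, of an affine function of slope `c(a)`. Graphs over the same set with slopes `c`,
`c'` have `n`-volumes within a factor `(1 + ‖c - c'‖) ^ n` of each other (`dist_graphMap_le`), so no
area formula is needed. If `m` is the pullback of volume by the graph at `x`, then `V(a)` is
squeezed between `m(D(a)) / K ^ n` and `K ^ n * m(D(a))`, with `K → 1`. Finally `m(D(a)) → m(D(x))`,
since the indicators converge off the null sets where the limit height is `0` or `1`. These are null
because the second non-zero coordinate makes the limit slope non-zero. -/

/-- If `f` expands distances on `s` at most `K` times as much as `g` does, then `f '' s` has
`d`-dimensional volume at most `K ^ d` times that of `g '' s`. -/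
lemma euclideanHausdorffMeasure_image_le_of_dist_le {α X Y : Type*}
    [MetricSpace X] [MeasurableSpace X] [BorelSpace X]
    [MetricSpace Y] [MeasurableSpace Y] [BorelSpace Y]
    {f : α → Y} {g : α → X} {s : Set α} {K : NNReal}
    (h : ∀ y ∈ s, ∀ z ∈ s, dist (f y) (f z) ≤ K * dist (g y) (g z)) (d : ℕ) :
    μHE[d] (f '' s) ≤ (K : ℝ≥0∞) ^ d * μHE[d] (g '' s) := by
  rcases s.eq_empty_or_nonempty with rfl | ⟨p, hp⟩
  · simp
  have : Nonempty α := ⟨p⟩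
  have hinv : ∀ q ∈ g '' s, ∃ y ∈ s, g y = q := fun q hq => hq
  choose! r hrs hrg using hinv
  -- Points of `s` with equal images under `g` have equal images under `f`, so the choice of `r` is
  -- harmless.
  have hfr : ∀ y ∈ s, f (r (g y)) = f y := by
    intro y hy
    have hm := mem_image_of_mem g hy
    have := h _ (hrs _ hm) _ hy
    rw [hrg _ hm, dist_self, mul_zero] at this
    exact dist_le_zero.1 this
  have himg : f '' s = (f ∘ r) '' (g '' s) := by
    rw [image_image]
    exact image_congr fun y hy => (hfr y hy).symm
  have hlip : LipschitzOnWith K (f ∘ r) (g '' s) := by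
    refine LipschitzOnWith.of_dist_le_mul fun q hq q' hq' => ?_
    have := h _ (hrs q hq) _ (hrs q' hq')
    rwa [hrg q hq, hrg q' hq'] at this
  rw [himg, Measure.euclideanHausdorffMeasure_def, Measure.euclideanHausdorffMeasure_def,
    Measure.smul_apply, Measure.smul_apply, ENNReal.smul_def, ENNReal.smul_def, smul_eq_mul,
    smul_eq_mul, mul_left_comm]
  gcongr
  simpa using hlip.hausdorffMeasure_image_le (Nat.cast_nonneg d)

/-- The parametrization of an affine hyperplane as a graph over all coordinates but the `i`-th. -/
noncomputable def graphMap {n : ℕ} (i : Fin (n + 1)) (c : EuclideanSpace ℝ (Fin n)) (e : ℝ)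
    (y : EuclideanSpace ℝ (Fin n)) : EuclideanSpace ℝ (Fin (n + 1)) :=
  WithLp.toLp 2 (i.insertNth (inner ℝ c y + e) y.ofLp)

section graphMap

variable {n : ℕ} (i : Fin (n + 1)) (c c' : EuclideanSpace ℝ (Fin n)) (e e' : ℝ)

@[simp]
lemma graphMap_apply_same (y : EuclideanSpace ℝ (Fin n)) :
    graphMap i c e y i = inner ℝ c y + e := by
  simp [graphMap]

@[simp]
lemma graphMap_apply_succAbove (y : EuclideanSpace ℝ (Fin n)) (j : Fin n) :
    graphMap i c e y (i.succAbove j) = y j := by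
  simp [graphMap]

lemma dist_graphMap_sq (y z : EuclideanSpace ℝ (Fin n)) :
    dist (graphMap i c e y) (graphMap i c e z) ^ 2 = inner ℝ c (y - z) ^ 2 + ‖y - z‖ ^ 2 := by
  rw [EuclideanSpace.dist_sq_eq, Fin.sum_univ_succAbove _ i, EuclideanSpace.norm_sq_eq]
  simp [Real.dist_eq, inner_sub_right]

/-- Changing the slope alters only the height difference, by at most `‖c - c'‖ * ‖y - z‖`; the
offsets cancel. -/
lemma dist_graphMap_le (y z : EuclideanSpace ℝ (Fin n)) :
    dist (graphMap i c e y) (graphMap i c e z) ≤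
      (1 + ‖c - c'‖₊ : NNReal) * dist (graphMap i c' e' y) (graphMap i c' e' z) := by
  set D := dist (graphMap i c' e' y) (graphMap i c' e' z) with hD
  have hDsq := dist_graphMap_sq i c' e' y z
  rw [← hD] at hDsq
  have hD0 : 0 ≤ D := dist_nonneg
  have hw : ‖y - z‖ ≤ D :=
    abs_le_of_sq_le_sq' (by nlinarith [sq_nonneg (inner ℝ c' (y - z))]) hD0 |>.2
  have hu : |inner ℝ c' (y - z)| ≤ D := abs_le_of_sq_le_sq (by nlinarith [sq_nonneg ‖y - z‖]) hD0
  have hcc : |inner ℝ (c - c') (y - z)| ≤ ‖c - c'‖ * ‖y - z‖ := abs_real_inner_le_norm _ _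
  have hsplit : inner ℝ c (y - z) = inner ℝ c' (y - z) + inner ℝ (c - c') (y - z) := by
    rw [← inner_add_left]; simp
  refine abs_le_of_sq_le_sq' ?_ (by positivity) |>.2
  rw [dist_graphMap_sq, hsplit]
  push_cast
  set u := inner ℝ c' (y - z)
  set v := inner ℝ (c - c') (y - z)
  set k := ‖c - c'‖
  have hk : 0 ≤ k := norm_nonneg _
  have hv : |v| ≤ k * D := hcc.trans (by gcongr)
  have h1 : u * v ≤ D * (k * D) := by
    calc u * v ≤ |u * v| := le_abs_self _
      _ = |u| * |v| := abs_mul _ _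
      _ ≤ D * (k * D) := by gcongr
  have h2 : v ^ 2 ≤ (k * D) ^ 2 := sq_le_sq' (by linarith [neg_abs_le v]) ((le_abs_self v).trans hv)
  nlinarith

lemma continuous_graphMap : Continuous (graphMap i c e) := by
  refine (PiLp.continuous_toLp 2 _).comp ?_
  refine continuous_pi fun j => ?_
  refine Fin.succAboveCases i ?_ (fun k => ?_) j
  · simp only [Fin.insertNth_apply_same]; fun_prop
  · simp only [Fin.insertNth_apply_succAbove]; fun_prop

lemma measurableEmbedding_graphMap : MeasurableEmbedding (graphMap i c e) := by
  refine (continuous_graphMap i c e).measurableEmbedding fun y z h => ?_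
  ext j
  have := congrArg (fun p : EuclideanSpace ℝ (Fin (n + 1)) => p (i.succAbove j)) h
  simpa using this

lemma measure_graphMap_image_le (s : Set (EuclideanSpace ℝ (Fin n))) :
    μHE[n] (graphMap i c e '' s) ≤
      ((1 + ‖c - c'‖₊ : NNReal) : ℝ≥0∞) ^ n * μHE[n] (graphMap i c' e' '' s) :=
  euclideanHausdorffMeasure_image_le_of_dist_le
    (fun y _ z _ => dist_graphMap_le i c c' e e' y z) n

lemma isometry_graphMap_zero : Isometry (graphMap i (0 : EuclideanSpace ℝ (Fin n)) e) := by
  refine Isometry.of_dist_eq fun y z => ?_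
  have h := dist_graphMap_sq i 0 e y z
  rw [inner_zero_left, zero_pow two_ne_zero, zero_add] at h
  rw [dist_eq_norm y z]
  exact (sq_eq_sq₀ dist_nonneg (norm_nonneg _)).1 h

lemma measure_graphMap_image_le_volume (s : Set (EuclideanSpace ℝ (Fin n))) :
    μHE[n] (graphMap i c e '' s) ≤ ((1 + ‖c‖₊ : NNReal) : ℝ≥0∞) ^ n * volume s := by
  have h := measure_graphMap_image_le i c 0 e 0 s
  rwa [(isometry_graphMap_zero i 0).euclideanHausdorffMeasure_image,
    EuclideanSpace.euclideanHausdorffMeasure_eq_volume, sub_zero] at h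

end graphMap

lemma isCompact_cube (d : ℕ) : IsCompact (cube d) := by
  have h : cube d = (WithLp.toLp 2) '' (Set.univ.pi fun _ : Fin d => Icc (0 : ℝ) 1) := by
    ext p
    constructor
    · intro hp
      exact ⟨p.ofLp, fun j _ => hp j, rfl⟩
    · rintro ⟨q, hq, rfl⟩ j
      exact hq j trivial
  rw [h]
  exact (isCompact_univ_pi fun _ => isCompact_Icc).image (PiLp.continuous_toLp 2 _)

/-- The points of the cube above which the graph of `y ↦ c · y + e` has height in `[0,1]`. -/
def graphDomain {n : ℕ} (c : EuclideanSpace ℝ (Fin n)) (e : ℝ) : Set (EuclideanSpace ℝ (Fin n)) :=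
  cube n ∩ {y | inner ℝ c y + e ∈ Icc (0 : ℝ) 1}

lemma measurableSet_graphDomain {n : ℕ} (c : EuclideanSpace ℝ (Fin n)) (e : ℝ) :
    MeasurableSet (graphDomain c e) := by
  have hc : Continuous fun y : EuclideanSpace ℝ (Fin n) => inner ℝ c y + e := by fun_prop
  exact ((isCompact_cube n).isClosed.inter (isClosed_Icc.preimage hc)).measurableSet

/-- The slope of `H(a)` seen as a graph over all coordinates but the `i`-th. -/
noncomputable def slope {n : ℕ} (i : Fin (n + 1)) (a : EuclideanSpace ℝ (Fin (n + 1))) :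
    EuclideanSpace ℝ (Fin n) :=
  WithLp.toLp 2 fun j => -a (i.succAbove j) / a i

lemma inner_slope {n : ℕ} (i : Fin (n + 1)) {a : EuclideanSpace ℝ (Fin (n + 1))} (ha : a i ≠ 0)
    (y : EuclideanSpace ℝ (Fin n)) :
    a i * inner ℝ (slope i a) y = -∑ j, a (i.succAbove j) * y j := by
  rw [PiLp.inner_apply, Finset.mul_sum, ← Finset.sum_neg_distrib]
  refine Finset.sum_congr rfl fun j _ => ?_
  simp only [slope, RCLike.inner_apply, conj_trivial]
  field_simp

lemma hyperplane_inter_cube_eq {n : ℕ} (t : ℝ) (i : Fin (n + 1))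
    {a : EuclideanSpace ℝ (Fin (n + 1))} (ha : a i ≠ 0) :
    hyperplane t a ∩ cube (n + 1) =
      graphMap i (slope i a) (offset t a / a i) '' graphDomain (slope i a) (offset t a / a i) := by
  have hinner : ∀ p : EuclideanSpace ℝ (Fin (n + 1)),
      inner ℝ a p = a i * p i + ∑ j, a (i.succAbove j) * p (i.succAbove j) := by
    intro p
    rw [PiLp.inner_apply, Fin.sum_univ_succAbove _ i]
    simp [mul_comm]
  ext p
  constructor
  · rintro ⟨hp, hpc⟩
    let y : EuclideanSpace ℝ (Fin n) := WithLp.toLp 2 fun j => p (i.succAbove j)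
    have hy : inner ℝ (slope i a) y + offset t a / a i = p i := by
      refine mul_left_cancel₀ ha ?_
      rw [mul_add, inner_slope i ha, mul_div_cancel₀ _ ha, ← show inner ℝ a p = offset t a from hp,
        hinner]
      simp [y]
    refine ⟨y, ⟨fun j => hpc _, ?_⟩, ?_⟩
    · rw [mem_ofPred_eq, hy]
      exact hpc i
    · ext j
      refine Fin.succAboveCases i ?_ (fun k => ?_) j
      · rw [graphMap_apply_same, hy]
      · simp [y]
  · rintro ⟨y, ⟨hyc, hy⟩, rfl⟩
    refine ⟨?_, fun j => ?_⟩
    · change inner ℝ a _ = offset t a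
      rw [hinner]
      simp only [graphMap_apply_same, graphMap_apply_succAbove]
      rw [mul_add, inner_slope i ha, mul_div_cancel₀ _ ha]
      ring
    · refine Fin.succAboveCases i ?_ (fun k => ?_) j
      · rw [graphMap_apply_same]; exact hy
      · rw [graphMap_apply_succAbove]; exact hyc k

lemma volume_setOf_inner_add_eq {n : ℕ} {c : EuclideanSpace ℝ (Fin n)} (hc : c ≠ 0) (e r : ℝ) :
    volume {y : EuclideanSpace ℝ (Fin n) | inner ℝ c y + e = r} = 0 := by
  let A : AffineSubspace ℝ (EuclideanSpace ℝ (Fin n)) :=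
    { carrier := {y | inner ℝ c y + e = r}
      smul_vsub_vadd_mem' := by
        intro k p q s hp hq hs
        simp only [mem_ofPred_eq, vsub_eq_sub, vadd_eq_add, inner_add_right, inner_smul_right,
          inner_sub_right] at *
        rw [show inner ℝ c p = inner ℝ c q by linarith]
        linarith }
  -- Were `A` the whole space, its equation at `0` and at `c` would give `‖c‖ ^ 2 = 0`.
  refine Measure.addHaar_affineSubspace volume A fun hA => hc ?_
  have hmem : ∀ y, inner ℝ c y + e = r := fun y => by
    have : y ∈ A := hA ▸ AffineSubspace.mem_top ℝ _ y
    exact this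
  have h0 := hmem 0
  have h1 := hmem c
  rw [inner_zero_right] at h0
  exact (inner_self_eq_zero (𝕜 := ℝ)).1 (by linarith)

lemma eventually_mem_Icc_iff {α : Type*} {l : Filter α} {u : α → ℝ} {v p q : ℝ}
    (hu : Tendsto u l (𝓝 v)) (hp : v ≠ p) (hq : v ≠ q) :
    ∀ᶠ a in l, u a ∈ Icc p q ↔ v ∈ Icc p q := by
  have h1 : ∀ᶠ a in l, p ≤ u a ↔ p ≤ v := by
    rcases hp.lt_or_gt with h | h
    · filter_upwards [hu.eventually_lt_const h] with a ha
      simp [not_le.2 ha, not_le.2 h]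
    · filter_upwards [hu.eventually_const_lt h] with a ha
      simp [ha.le, h.le]
  have h2 : ∀ᶠ a in l, u a ≤ q ↔ v ≤ q := by
    rcases hq.lt_or_gt with h | h
    · filter_upwards [hu.eventually_lt_const h] with a ha
      simp [ha.le, h.le]
    · filter_upwards [hu.eventually_const_lt h] with a ha
      simp [not_le.2 ha, not_le.2 h]
  filter_upwards [h1, h2] with a ha hb
  rw [mem_Icc, mem_Icc, ha, hb]

/-- The volume above a fixed finite measure of the domain of a graph depends continuously on the
graph, if the limit graph is not horizontal. -/
lemma tendsto_measure_graphDomain {α : Type*} {l : Filter α} [l.IsCountablyGenerated] {n : ℕ}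
    {μ : Measure (EuclideanSpace ℝ (Fin n))} (hμ : μ ≪ volume) (hfin : μ (cube n) ≠ ⊤)
    {c : α → EuclideanSpace ℝ (Fin n)} {e : α → ℝ} {c₀ : EuclideanSpace ℝ (Fin n)} {e₀ : ℝ}
    (hc : Tendsto c l (𝓝 c₀)) (he : Tendsto e l (𝓝 e₀)) (hc₀ : c₀ ≠ 0) :
    Tendsto (fun a => μ (graphDomain (c a) (e a))) l (𝓝 (μ (graphDomain c₀ e₀))) := by
  refine tendsto_measure_of_ae_tendsto_indicator l (measurableSet_graphDomain _ _)
    (fun a => measurableSet_graphDomain _ _) (isCompact_cube n).isClosed.measurableSet hfin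
    (Eventually.of_forall fun a => inter_subset_left) ?_
  have hne : ∀ r, ∀ᵐ y ∂μ, inner ℝ c₀ y + e₀ ≠ r := fun r =>
    hμ.ae_le (ae_iff.2 (by simpa using volume_setOf_inner_add_eq hc₀ e₀ r))
  filter_upwards [hne 0, hne 1] with y h0 h1
  filter_upwards [eventually_mem_Icc_iff ((hc.inner tendsto_const_nhds).add he) h0 h1] with a ha
  exact and_congr_right fun _ => ha

theorem continuousAt_sectionVolume_succ {n : ℕ} (t : ℝ) (x : EuclideanSpace ℝ (Fin (n + 1)))
    {i j : Fin (n + 1)} (hij : i ≠ j) (hi : x i ≠ 0) (hj : x j ≠ 0) :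
    sectionVolume t x ≠ ⊤ ∧ ContinuousAt (fun a => sectionVolume t a) x := by
  set c := slope i x with hcdef
  set e := offset t x / x i with hedef
  have hV : ∀ a : EuclideanSpace ℝ (Fin (n + 1)), a i ≠ 0 → sectionVolume t a =
      μHE[n] (graphMap i (slope i a) (offset t a / a i) ''
        graphDomain (slope i a) (offset t a / a i)) := by
    intro a ha
    rw [sectionVolume, hyperplane_inter_cube_eq t i ha, Nat.add_sub_cancel]
  set m : Measure (EuclideanSpace ℝ (Fin n)) := Measure.comap (graphMap i c e) μHE[n] with hm
  have hm_apply : ∀ s, m s = μHE[n] (graphMap i c e '' s) :=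
    fun s => (measurableEmbedding_graphMap i c e).comap_apply _ s
  have hle : ∀ s, m s ≤ ((1 + ‖c‖₊ : NNReal) : ℝ≥0∞) ^ n * volume s := fun s => by
    rw [hm_apply]
    exact measure_graphMap_image_le_volume i c e s
  have hac : m ≪ volume := fun s hs => by simpa [hs] using hle s
  have hfin : m (cube n) ≠ ⊤ := ne_top_of_le_ne_top
    (ENNReal.mul_ne_top (ENNReal.pow_ne_top ENNReal.coe_ne_top)
      (isCompact_cube n).measure_lt_top.ne) (hle _)
  have hVx : sectionVolume t x = m (graphDomain c e) := by rw [hV x hi, hm_apply]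
  have hxi : Tendsto (fun a : EuclideanSpace ℝ (Fin (n + 1)) => a i) (𝓝 x) (𝓝 (x i)) :=
    (show Continuous fun a : EuclideanSpace ℝ (Fin (n + 1)) => a i by fun_prop).tendsto x
  have hctend : Tendsto (slope i) (𝓝 x) (𝓝 c) := by
    refine ((PiLp.continuous_toLp 2 _).tendsto _).comp (tendsto_pi_nhds.2 fun k => ?_)
    refine Tendsto.div ?_ hxi hi
    exact (show Continuous fun a : EuclideanSpace ℝ (Fin (n + 1)) => -a (i.succAbove k)
      by fun_prop).tendsto x
  have hetend : Tendsto (fun a => offset t a / a i) (𝓝 x) (𝓝 e) := by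
    refine Tendsto.div ?_ hxi hi
    exact (show Continuous fun a : EuclideanSpace ℝ (Fin (n + 1)) => offset t a
      by unfold offset; fun_prop).tendsto x
  have hc0 : c ≠ 0 := by
    obtain ⟨k, rfl⟩ := Fin.exists_succAbove_eq hij.symm
    intro h
    have := congrArg (fun p : EuclideanSpace ℝ (Fin n) => p k) h
    simp [hcdef, slope, hi, hj] at this
  have hmt := tendsto_measure_graphDomain hac hfin hctend hetend hc0
  have hK : Tendsto (fun a => ((1 + ‖slope i a - c‖₊ : NNReal) : ℝ≥0∞) ^ n) (𝓝 x) (𝓝 1) := by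
    have h1 : Tendsto (fun a => (1 + ‖slope i a - c‖₊ : NNReal) ^ n) (𝓝 x)
        (𝓝 ((1 + ‖c - c‖₊) ^ n)) :=
      ((tendsto_const_nhds.add (hctend.sub_const c).nnnorm).pow n)
    simpa using ENNReal.tendsto_coe.2 h1
  have hmfin : m (graphDomain c e) ≠ ⊤ := ne_top_of_le_ne_top hfin (measure_mono inter_subset_left)
  refine ⟨hVx ▸ hmfin, ?_⟩
  have hne : ∀ᶠ a in 𝓝 x, a i ≠ 0 := hxi.eventually_ne hi
  rw [ContinuousAt, hVx]
  refine tendsto_of_tendsto_of_tendsto_of_le_of_le'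
    (g := fun a => m (graphDomain (slope i a) (offset t a / a i)) /
      ((1 + ‖slope i a - c‖₊ : NNReal) : ℝ≥0∞) ^ n)
    (h := fun a => ((1 + ‖slope i a - c‖₊ : NNReal) : ℝ≥0∞) ^ n *
      m (graphDomain (slope i a) (offset t a / a i))) ?_ ?_ ?_ ?_
  · simpa using ENNReal.Tendsto.div hmt (Or.inr one_ne_zero) hK (Or.inl ENNReal.one_ne_top)
  · simpa using ENNReal.Tendsto.mul hK (Or.inl one_ne_zero) hmt (Or.inr ENNReal.one_ne_top)
  · filter_upwards [hne] with a ha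
    refine ENNReal.div_le_of_le_mul' ?_
    -- The lower bound is the same comparison with the two slopes exchanged.
    rw [hV a ha, hm_apply, ← nnnorm_neg, neg_sub]
    exact measure_graphMap_image_le i _ _ _ _ _
  · filter_upwards [hne] with a ha
    rw [hV a ha, hm_apply]
    exact measure_graphMap_image_le i _ _ _ _ _

end HypercubeSection

theorem mainTheorem5 (d : ℕ) (t : ℝ) (x : EuclideanSpace ℝ (Fin d))
    (hx : ∀ i, 0 ≤ x i) (hx2 : ∃ i j, i ≠ j ∧ x i ≠ 0 ∧ x j ≠ 0) :
    HypercubeSection.sectionVolume t x ≠ ⊤ ∧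
      ContinuousAt (fun a : EuclideanSpace ℝ (Fin d) => HypercubeSection.sectionVolume t a) x := by
  obtain ⟨i, j, hij, hi, hj⟩ := hx2
  cases d with
  | zero => exact i.elim0
  | succ n => exact HypercubeSection.continuousAt_sectionVolume_succ t x hij hi hj
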